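/- Let $(R,\mathfrak m,k)$ be a (commutative, noetherian) Cohen–Macaulay local ring of Krull dimension one whose residue field $k$ is infinite. Suppose that the associated graded ring $\operatorname{gr}_{\mathfrak m}R=\bigoplus_{n\ge 0}\mathfrak m^n/\mathfrak m^{n+1}$ has positive depth (with respect to its homogeneous maximal ideal $\bigoplus_{n\ge 1}\mathfrak m^n/\mathfrak m^{n+1}$). For a finitely generated $R$-module $M$, let $\operatorname{ext}_RM$ be the smallest strictly full subcategory of the category $\operatorname{mod}R$ of finitely generated $R$-modules which contains $M$ and is closed under direct summands and extensions. Then for every integer $i\ge 1$: 1. $\operatorname{ext}_R(R/\mathfrak m^i)=\operatorname{fl}R$, the subcategory of all $R$-modules of finite length; 2. $\operatorname{ext}_R(\mathfrak m^i)=\operatorname{tf}_0R$, the subcategory of all finitely generated $R$-modules $M$ that are torsionfree (every nonzerodivisor of $R$ is a nonzerodivisor on $M$) and generically free ($M_{\mathfrak p}$ is a free $R_{\mathfrak p}$-module for every minimal prime $\mathfrak p$ of $R$). -/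

import Mathlib

open CategoryTheory

universe u

noncomputable section

namespace ExtensionClosure

/-! ### Depth and Cohen–Macaulay local rings -/

/-- The grade of an ideal `I` on a module `M` (the `I`-depth of `M`), for `M ≠ I M`: the supremum
of the lengths of the `M`-regular sequences consisting of elements of `I`. -/
def idealDepth {A : Type*} [CommRing A] (I : Ideal A) (M : Type*) [AddCommGroup M] [Module A M] :
    ℕ∞ :=
  ⨆ rs : {rs : List A // (∀ a ∈ rs, a ∈ I) ∧ RingTheory.Sequence.IsRegular M rs},
    (rs.1.length : ℕ∞)

/-- A (commutative) noetherian local ring is Cohen–Macaulay if its depth, the grade of its maximal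
ideal on the ring itself, equals its Krull dimension. -/
def IsCohenMacaulayLocal (R : Type*) [CommRing R] [IsNoetherianRing R] [IsLocalRing R] : Prop :=
  ((idealDepth (IsLocalRing.maximalIdeal R) R : ℕ∞) : WithBot ℕ∞) = ringKrullDim R

/-! ### The associated graded ring -/

section AssociatedGraded

variable {R : Type u} [CommRing R] (I : Ideal R)

/-- The ideal `⨁ Iⁿ⁺¹ tⁿ` of the Rees algebra `⨁ Iⁿ tⁿ ⊆ R[t]`. -/
def reesShift : Ideal (reesAlgebra I) where
  carrier := {f | ∀ n, (f : Polynomial R).coeff n ∈ I ^ (n + 1)}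
  add_mem' {f g} hf hg n := by
    simpa using Ideal.add_mem _ (hf n) (hg n)
  zero_mem' n := by simp
  smul_mem' c f hf n := by
    rw [smul_eq_mul, MulMemClass.coe_mul, Polynomial.coeff_mul]
    refine Ideal.sum_mem _ fun ij hij => ?_
    rw [← Finset.HasAntidiagonal.mem_antidiagonal.mp hij, add_assoc, pow_add]
    exact Ideal.mul_mem_mul (c.2 ij.1) (hf ij.2)

/-- The associated graded ring `gr_I R = ⨁ Iⁿ / Iⁿ⁺¹`, with the multiplication induced by that
of `R`: it is the quotient of the graded ring `⨁ Iⁿ tⁿ` by its homogeneous ideal `⨁ Iⁿ⁺¹ tⁿ`. -/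
def AssociatedGraded : Type u := reesAlgebra I ⧸ reesShift I

instance : CommRing (AssociatedGraded I) :=
  inferInstanceAs (CommRing (reesAlgebra I ⧸ reesShift I))

/-- The projection of the Rees algebra `⨁ Iⁿ tⁿ` onto `gr_I R`. -/
def AssociatedGraded.mk : reesAlgebra I →+* AssociatedGraded I :=
  Ideal.Quotient.mk (reesShift I)

theorem AssociatedGraded.mk_surjective : Function.Surjective (AssociatedGraded.mk I) :=
  Ideal.Quotient.mk_surjective

/-- The component of degree `n` of `gr_I R` is `Iⁿ / Iⁿ⁺¹`. -/
theorem AssociatedGraded.mk_eq_zero_iff (f : reesAlgebra I) :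
    AssociatedGraded.mk I f = 0 ↔ ∀ n, (f : Polynomial R).coeff n ∈ I ^ (n + 1) :=
  Ideal.Quotient.eq_zero_iff_mem

/-- The projection of `gr_I R` onto its component `R / I` of degree zero. -/
def degreeZero : AssociatedGraded I →+* R ⧸ I :=
  Ideal.Quotient.lift (reesShift I)
    ((Ideal.Quotient.mk I).comp (Polynomial.constantCoeff.comp (reesAlgebra I).val.toRingHom))
    (fun f hf => Ideal.Quotient.eq_zero_iff_mem.mpr (by simpa using hf 0))

/-- The irrelevant ideal `gr_+ = ⨁_{n ≥ 1} Iⁿ / Iⁿ⁺¹` of `gr_I R`. -/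
def irrelevantIdeal : Ideal (AssociatedGraded I) := RingHom.ker (degreeZero I)

theorem mk_mem_irrelevantIdeal_iff (f : reesAlgebra I) :
    AssociatedGraded.mk I f ∈ irrelevantIdeal I ↔ (f : Polynomial R).coeff 0 ∈ I :=
  Ideal.Quotient.eq_zero_iff_mem

end AssociatedGraded

/-- The depth of the associated graded ring `gr_𝔪 R` of a local ring `(R, 𝔪)`. The component of
degree zero is the field `R / 𝔪`, so that `gr_+` is the homogeneous maximal ideal of `gr_𝔪 R`;
the depth is the grade of this ideal. -/
def depthAssociatedGraded (R : Type u) [CommRing R] [IsLocalRing R] : ℕ∞ :=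
  idealDepth (irrelevantIdeal (IsLocalRing.maximalIdeal R))
    (AssociatedGraded (IsLocalRing.maximalIdeal R))

/-! ### Subcategories of `mod R` -/

section Subcategories

variable (R : Type u) [CommRing R]

/-- `ext_R M`: the smallest subcategory of the category `mod R` of finitely generated modules which
contains `M` and is closed under direct summands and extensions. -/
def extClosure [IsNoetherianRing R] (M : FGModuleCat.{u} R) : ObjectProperty (FGModuleCat.{u} R) :=
  sInf {P | P M ∧ P.IsStableUnderRetracts ∧ P.IsClosedUnderExtensions}

/-- `fl R`: the modules of finite length. -/
def finiteLengthModules : ObjectProperty (FGModuleCat.{u} R) :=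
  fun X => IsFiniteLength R X

/-- A module is generically free if its localization at each minimal prime of the ring is free. -/
def IsGenericallyFree (M : Type u) [AddCommGroup M] [Module R M] : Prop :=
  ∀ (p : Ideal R) [p.IsPrime], p ∈ minimalPrimes R →
    Module.Free (Localization.AtPrime p) (LocalizedModule p.primeCompl M)

/-- `tf₀ R`: the modules which are torsionfree (every nonzerodivisor of the ring is a
nonzerodivisor on the module) and generically free. -/
def genericallyFreeTorsionfreeModules : ObjectProperty (FGModuleCat.{u} R) :=
  fun X => Module.IsTorsionFree R X ∧ IsGenericallyFree R X

end Subcategories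

end ExtensionClosure

end

/-!
The proof rests on one element `x ∈ 𝔪` whose class in degree one is a nonzerodivisor on `gr_𝔪 R`.
It exists because the residue field is infinite: none of the finitely many associated primes of
`gr_𝔪 R` contains all forms of degree one, as these generate the irrelevant ideal
(`exists_regular_form`). Then `x` is a nonzerodivisor of `R` and `x z ∈ 𝔪ⁿ⁺¹` forces `z ∈ 𝔪ⁿ`
(`exists_superficial`).

Let `I` be an ideal between `𝔪ⁿ⁺²` and `𝔪ⁿ⁺¹` whose image in `𝔪ⁿ⁺¹ / 𝔪ⁿ⁺²` is a complement of the
image of `x 𝔪ⁿ`. The split exact sequence `0 → R → R × R → R → 0` with maps `a ↦ (x a, a)` and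
`(b, c) ↦ b - x c` restricts to an exact sequence `0 → 𝔪ⁿ⁺¹ → I × 𝔪ⁿ → 𝔪ⁿ⁺¹ → 0`, and hence also
induces `0 → R/𝔪ⁿ⁺¹ → R/I × R/𝔪ⁿ → R/𝔪ⁿ⁺¹ → 0`. So a subcategory closed under extensions and
direct summands that contains `𝔪ⁿ⁺¹` contains `𝔪ⁿ`, and likewise for `R/𝔪ⁿ⁺¹` and `R/𝔪ⁿ`
(`prop_maximalIdeal_pow_of_succ`, `prop_quotient_maximalIdeal_pow_of_succ`). Descending from `i`,
the extension closure of `R/𝔪ⁱ` contains the residue field, hence all modules of finite length,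
and that of `𝔪ⁱ` contains both `𝔪` and `R`.

It remains to see that `R` and `𝔪` generate every torsionfree, generically free module `M`. Take a
free cover `π : F → M`. As all associated primes of `R` are minimal, there are a nonzerodivisor `r`
and a map `s : M → F` with `π s = r` (`IsGenericallyFree.exists_comp_eq_smul`), and this makes `M` a
direct summand of `π⁻¹(r M)`, the kernel of the map from `F` onto the module `M / r M`, which has
finite length. Such kernels are reached from `F` by induction on the length: the kernel of a map from `L` onto the
residue field is a direct summand of an extension of `L` by `𝔪` (`prop_ker_of_isSimpleModule`).
-/

namespace ExtensionClosure

open IsLocalRing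

/-! ### Regular elements of degree one -/

/-- A module over a local ring with infinite residue field is not a finite union of proper
submodules. -/
theorem exists_notMem_of_finite_of_ne_top {R M ι : Type*} [CommRing R] [IsLocalRing R]
    [Infinite (ResidueField R)] [AddCommGroup M] [Module R M] {s : Set ι} (hs : s.Finite)
    (N : ι → Submodule R M) (hN : ∀ j ∈ s, N j ≠ ⊤) : ∃ v : M, ∀ j ∈ s, v ∉ N j := by
  by_contra! h
  have hcover : ⋃ j ∈ hs.toFinset, (N j : Set M) = Set.univ := by
    ext v
    simpa using h v
  obtain ⟨j, hj, hfin⟩ := Submodule.exists_finiteIndex_of_cover hcover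
  have : Finite (M ⧸ N j) := AddSubgroup.finite_quotient_of_finiteIndex
  have : Nontrivial (M ⧸ N j) :=
    Submodule.Quotient.nontrivial_iff.mpr (hN j (hs.mem_toFinset.mp hj))
  -- A nonzero element `v` of the finite module `M / N j` generates a finite module `R / ann v`,
  -- and the residue field is a quotient of the latter.
  obtain ⟨v, hv⟩ := exists_ne (0 : M ⧸ N j)
  let f : R →ₗ[R] M ⧸ N j := LinearMap.toSpanSingleton R _ v
  have hle : LinearMap.ker f ≤ maximalIdeal R := by
    refine le_maximalIdeal fun h => hv ?_
    have : (1 : R) ∈ LinearMap.ker f := h ▸ Submodule.mem_top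
    simpa [f] using this
  have : Finite (R ⧸ LinearMap.ker f) := 
    Finite.of_equiv (LinearMap.range f) f.quotKerEquivRange.symm.toEquiv
  have : Finite (ResidueField R) :=
    Finite.of_surjective _ (Submodule.factor_surjective hle)
  exact not_finite (ResidueField R)

section Superficial

variable {R : Type u} [CommRing R]

/-- The homogeneous element `z tⁿ` of the Rees algebra. -/
noncomputable def reesMonomial (I : Ideal R) (n : ℕ) (z : R) (hz : z ∈ I ^ n) : reesAlgebra I :=
  ⟨Polynomial.monomial n z, reesAlgebra.monomial_mem.mpr hz⟩

theorem mk_reesMonomial_eq_zero_iff (I : Ideal R) (n : ℕ) (z : R) (hz : z ∈ I ^ n) :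
    AssociatedGraded.mk I (reesMonomial I n z hz) = 0 ↔ z ∈ I ^ (n + 1) := by
  rw [AssociatedGraded.mk_eq_zero_iff]
  refine ⟨fun h => by simpa [reesMonomial] using h n, fun h k => ?_⟩
  simp only [reesMonomial, Polynomial.coeff_monomial]
  split_ifs with hk
  · exact hk ▸ h
  · exact zero_mem _

theorem reesMonomial_mul (I : Ideal R) {a b : ℕ} {y z : R} (hy : y ∈ I ^ a) (hz : z ∈ I ^ b) :
    reesMonomial I a y hy * reesMonomial I b z hz =
      reesMonomial I (a + b) (y * z) (pow_add I a b ▸ Ideal.mul_mem_mul hy hz) :=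
  Subtype.ext (Polynomial.monomial_mul_monomial ..)

theorem reesMonomial_add (I : Ideal R) {a : ℕ} {y z : R} (hy : y ∈ I ^ a) (hz : z ∈ I ^ a) :
    reesMonomial I a y hy + reesMonomial I a z hz =
      reesMonomial I a (y + z) (add_mem hy hz) :=
  Subtype.ext (map_add (Polynomial.monomial a) y z).symm

theorem algebraMap_mul_reesMonomial (I : Ideal R) {a : ℕ} (r : R) {z : R} (hz : z ∈ I ^ a) :
    algebraMap R (reesAlgebra I) r * reesMonomial I a z hz =
      reesMonomial I a (r * z) (Ideal.mul_mem_left _ r hz) :=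
  Subtype.ext (Polynomial.C_mul_monomial (a := r) (b := z) (n := a))

theorem eq_sum_reesMonomial (I : Ideal R) (f : reesAlgebra I) :
    f = ∑ n ∈ (f : Polynomial R).support,
      reesMonomial I n ((f : Polynomial R).coeff n) (f.2 n) := by
  refine Subtype.ext ?_
  rw [AddSubmonoidClass.coe_finsetSum]
  exact (f : Polynomial R).as_sum_support

theorem mk_reesMonomial_mem {I : Ideal R} {P : Ideal (AssociatedGraded I)}
    (h : ∀ y (hy : y ∈ I ^ 1), AssociatedGraded.mk I (reesMonomial I 1 y hy) ∈ P)
    {n : ℕ} (hn : 1 ≤ n) : ∀ z (hz : z ∈ I ^ n),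
      AssociatedGraded.mk I (reesMonomial I n z hz) ∈ P := by
  induction n, hn using Nat.le_induction with
  | base => exact h
  | succ n hn ih =>
    intro z hz
    suffices ∀ z ∈ I ^ n * I ^ 1, ∃ hz : z ∈ I ^ (n + 1),
        AssociatedGraded.mk I (reesMonomial I (n + 1) z hz) ∈ P from
      (this z (by rwa [← pow_add])).2
    intro z hz
    induction hz using Submodule.mul_induction_on' with
    | mem_mul_mem a ha b hb =>
      have := P.mul_mem_left (AssociatedGraded.mk I (reesMonomial I n a ha)) (h b hb)
      rw [← map_mul, reesMonomial_mul] at this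
      exact ⟨_, this⟩
    | add a ha b hb hPa hPb =>
      obtain ⟨ha, hPa⟩ := hPa
      obtain ⟨hb, hPb⟩ := hPb
      have := P.add_mem hPa hPb
      rw [← map_add, reesMonomial_add] at this
      exact ⟨_, this⟩

/-- An ideal of `gr_I R` that contains the component of degree one contains the irrelevant
ideal, since the Rees algebra is generated in degree one. -/
theorem irrelevantIdeal_le (I : Ideal R) (P : Ideal (AssociatedGraded I))
    (h : ∀ y (hy : y ∈ I ^ 1), AssociatedGraded.mk I (reesMonomial I 1 y hy) ∈ P) :
    irrelevantIdeal I ≤ P := by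
  intro a ha
  obtain ⟨f, rfl⟩ := AssociatedGraded.mk_surjective I a
  rw [mk_mem_irrelevantIdeal_iff] at ha
  rw [eq_sum_reesMonomial I f, map_sum]
  refine P.sum_mem fun n _ => ?_
  rcases Nat.eq_zero_or_pos n with hn | hn
  · have h0 : AssociatedGraded.mk I (reesMonomial I n ((f : Polynomial R).coeff n) (f.2 n)) = 0 :=
      (mk_reesMonomial_eq_zero_iff I n _ _).mpr (by simpa [hn] using ha)
    exact h0 ▸ zero_mem P
  · exact mk_reesMonomial_mem h hn _ _

instance [IsNoetherianRing R] (I : Ideal R) : IsNoetherianRing (AssociatedGraded I) :=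
  isNoetherianRing_of_surjective _ _ _ (AssociatedGraded.mk_surjective I)

/-- If the associated graded ring has positive depth and the residue field is infinite, then some
form of degree one is a nonzerodivisor on the associated graded ring: a vector space over an
infinite field is not the union of the traces of the finitely many associated primes. -/
theorem exists_regular_form [IsNoetherianRing R] [IsLocalRing R]
    [Infinite (ResidueField R)] (hgr : 0 < depthAssociatedGraded R) :
    ∃ x, ∃ hx : x ∈ maximalIdeal R, AssociatedGraded.mk (maximalIdeal R)
      (reesMonomial (maximalIdeal R) 1 x (by simpa using hx)) ∈
        nonZeroDivisors (AssociatedGraded (maximalIdeal R)) := by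
  let G := AssociatedGraded (maximalIdeal R)
  obtain ⟨⟨rs, hmem, hrs⟩, hlen⟩ := lt_iSup_iff.mp hgr
  obtain ⟨a, rs, rfl⟩ : ∃ a l, rs = a :: l :=
    List.exists_cons_of_ne_nil fun h => by simp [h] at hlen
  have hareg : a ∈ nonZeroDivisors G := mem_nonZeroDivisors_iff_left.mpr fun b hb =>
    ((RingTheory.Sequence.isRegular_cons_iff _ _ _).mp hrs).1 (by simpa using hb)
  have hass := biUnion_associatedPrimes_eq_compl_nonZeroDivisors G
  -- The elements of `𝔪` whose class in degree one lies in a given ideal of `gr R`.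
  let N : Ideal G → Submodule R (maximalIdeal R) := fun P =>
    { carrier := {y | AssociatedGraded.mk (maximalIdeal R)
        (reesMonomial (maximalIdeal R) 1 (y : R) (by simp)) ∈ P}
      zero_mem' := by
        have h0 := (mk_reesMonomial_eq_zero_iff (maximalIdeal R) 1 0 (zero_mem _)).mpr (zero_mem _)
        exact (congrArg (· ∈ P) h0).mpr (zero_mem P)
      add_mem' := fun {y z} hy hz => by
        have h := P.add_mem hy hz
        rwa [← map_add, reesMonomial_add] at h
      smul_mem' := fun r y hy => by
        have h := P.mul_mem_left (AssociatedGraded.mk _ (algebraMap R _ r)) hy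
        rwa [← map_mul, algebraMap_mul_reesMonomial] at h }
  obtain ⟨v, hv⟩ := exists_notMem_of_finite_of_ne_top (associatedPrimes.finite G G) N
    fun P hP htop => by
      have hle := irrelevantIdeal_le _ P fun y hy =>
        show (⟨y, by simpa using hy⟩ : maximalIdeal R) ∈ N P from htop ▸ Submodule.mem_top
      have : a ∈ (nonZeroDivisors G : Set G)ᶜ :=
        hass ▸ Set.mem_biUnion hP (hle (hmem a (by simp)))
      exact this hareg
  refine ⟨v, v.2, ?_⟩
  by_contra hnot
  have hnot' : AssociatedGraded.mk (maximalIdeal R) (reesMonomial _ 1 (v : R) (by simp)) ∈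
      ⋃ P ∈ associatedPrimes G G, (P : Set G) := hass ▸ hnot
  obtain ⟨P, hP, hvP⟩ := Set.mem_iUnion₂.mp hnot'
  exact hv P hP hvP

/-- Multiplication by an element `x ∈ I` whose class in degree one is a nonzerodivisor on `gr_I R`
is strict for the `I`-adic filtration. -/
theorem mem_pow_of_mul_mem_pow (I : Ideal R) {x : R} (hx : x ∈ I)
    (hreg : AssociatedGraded.mk I (reesMonomial I 1 x (by simpa using hx)) ∈
      nonZeroDivisors (AssociatedGraded I)) {n : ℕ} {z : R} (hz : x * z ∈ I ^ (n + 1)) :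
    z ∈ I ^ n := by
  suffices ∀ j ≤ n, z ∈ I ^ j from this n le_rfl
  intro j
  induction j with
  | zero => simp
  | succ j ih =>
    intro hj
    have hzj := ih (by omega)
    rw [← mk_reesMonomial_eq_zero_iff I j z hzj]
    refine (mem_nonZeroDivisors_iff.mp hreg).1 _ ?_
    rw [← map_mul, reesMonomial_mul, mk_reesMonomial_eq_zero_iff]
    exact Ideal.pow_le_pow_right (by omega) hz

/-- There is a nonzerodivisor `x ∈ 𝔪` such that multiplication by `x` is strict for the `𝔪`-adic
filtration. -/
theorem exists_superficial [IsNoetherianRing R] [IsLocalRing R]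
    [Infinite (ResidueField R)] (hgr : 0 < depthAssociatedGraded R) :
    ∃ x ∈ maximalIdeal R, x ∈ nonZeroDivisors R ∧
      ∀ n z, x * z ∈ maximalIdeal R ^ (n + 1) → z ∈ maximalIdeal R ^ n := by
  obtain ⟨x, hx, hreg⟩ := exists_regular_form hgr
  have hcolon : ∀ n z, x * z ∈ maximalIdeal R ^ (n + 1) → z ∈ maximalIdeal R ^ n :=
    fun n z => mem_pow_of_mul_mem_pow _ hx hreg
  refine ⟨x, hx, mem_nonZeroDivisors_iff_left.mpr fun z hz => ?_, hcolon⟩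
  have hmem : z ∈ ⨅ n, maximalIdeal R ^ n :=
    (Submodule.mem_iInf _).mpr fun n => hcolon n z (hz ▸ zero_mem _)
  rwa [Ideal.iInf_pow_eq_bot_of_isLocalRing _ (maximalIdeal.isMaximal R).ne_top] at hmem

end Superficial

/-! ### Complements in the filtration by powers of an ideal -/

section Complement

variable {R : Type u} [CommRing R] [IsNoetherianRing R] [IsLocalRing R]

/-- The image of `x 𝔪ⁿ` in the `R / 𝔪`-vector space `𝔪ⁿ⁺¹ / 𝔪ⁿ⁺²` has a complement. -/
theorem exists_ideal_complement (x : R) (n : ℕ) :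
    ∃ I : Ideal R, maximalIdeal R ^ (n + 2) ≤ I ∧ I ≤ maximalIdeal R ^ (n + 1) ∧
      (∀ z ∈ maximalIdeal R ^ n, x * z ∈ I → x * z ∈ maximalIdeal R ^ (n + 2)) ∧
      ∀ b ∈ maximalIdeal R ^ (n + 1), ∃ z ∈ maximalIdeal R ^ n, b - x * z ∈ I := by
  let S : Set (Ideal R) := {I | maximalIdeal R ^ (n + 2) ≤ I ∧ I ≤ maximalIdeal R ^ (n + 1) ∧
    ∀ z ∈ maximalIdeal R ^ n, x * z ∈ I → x * z ∈ maximalIdeal R ^ (n + 2)}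
  obtain ⟨I, ⟨hI₁, hI₂, hI₃⟩, hmax⟩ := set_has_maximal_iff_noetherian.mpr
    (inferInstance : IsNoetherian R R) S
    ⟨_, le_rfl, Ideal.pow_le_pow_right (by omega), fun _ _ h => h⟩
  refine ⟨I, hI₁, hI₂, hI₃, fun b hb => ?_⟩
  -- Otherwise `I + (b)` contradicts the maximality of `I`: if `r b + c = x z` with `c ∈ I`, then
  -- `r` is not a unit by the choice of `b`, so that `r b ∈ 𝔪ⁿ⁺²` and hence `x z ∈ I`.
  by_contra! hcon
  have hbI : b ∉ I := fun h => hcon 0 (zero_mem _) (by simpa using h)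
  refine hmax (I ⊔ Ideal.span {b}) ⟨hI₁.trans le_sup_left,
    sup_le hI₂ ((Ideal.span_singleton_le_iff_mem _).mpr hb), fun z hz hxz => ?_⟩
    (lt_of_le_of_ne le_sup_left fun h => hbI (h ▸ Ideal.mem_sup_right
      (Ideal.mem_span_singleton_self b)))
  obtain ⟨r, hr⟩ := Ideal.mem_span_singleton_sup.mp (sup_comm I _ ▸ hxz)
  obtain ⟨c, hc, hrc⟩ := hr
  by_cases hunit : IsUnit r
  · obtain ⟨u, rfl⟩ := hunit
    refine absurd ?_ (hcon (↑u⁻¹ * z) (Ideal.mul_mem_left _ _ hz))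
    have : b - x * (↑u⁻¹ * z) = -(↑u⁻¹ * c) := by
      have h1 : (↑u⁻¹ : R) * ↑u = 1 := u.inv_mul
      linear_combination (-b) * h1 + ↑u⁻¹ * hrc
    rw [this]
    exact neg_mem (Ideal.mul_mem_left _ _ hc)
  · refine hI₃ z hz (hrc ▸ add_mem (hI₁ ?_) hc)
    rw [pow_succ' _ (n + 1)]
    exact Ideal.mul_mem_mul ((mem_maximalIdeal r).mpr hunit) hb

end Complement

/-! ### Torsionfree generically free modules -/

section GenericallyFree

variable {R : Type u} [CommRing R] {M N K : Type u} [AddCommGroup M] [Module R M]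
  [AddCommGroup N] [Module R N] [AddCommGroup K] [Module R K]

theorem IsGenericallyFree.of_retract [Module.Finite R M] (i : M →ₗ[R] N) (r : N →ₗ[R] M)
    (h : r ∘ₗ i = LinearMap.id) (hN : IsGenericallyFree R N) : IsGenericallyFree R M := by
  intro p _ hp
  have := hN p hp
  have : Module.Projective (Localization.AtPrime p) (LocalizedModule p.primeCompl M) := by
    refine Module.Projective.of_split (LocalizedModule.map p.primeCompl i)
      (LocalizedModule.map p.primeCompl r) ?_
    refine LinearMap.ext fun v => ?_
    induction v using LocalizedModule.induction_on with | _ v s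
    have hv : r (i v) = v := LinearMap.congr_fun h v
    rw [LinearMap.comp_apply, LocalizedModule.map_mk, LocalizedModule.map_mk, hv,
      LinearMap.id_apply]
  exact Module.free_of_flat_of_isLocalRing

theorem IsGenericallyFree.of_exact (f : M →ₗ[R] N) (g : N →ₗ[R] K)
    (hf : Function.Injective f) (hg : Function.Surjective g) (hfg : Function.Exact f g)
    (hM : IsGenericallyFree R M) (hK : IsGenericallyFree R K) : IsGenericallyFree R N := by
  intro p _ hp
  have := hM p hp
  have := hK p hp
  let f' := LocalizedModule.map p.primeCompl f
  let g' := LocalizedModule.map p.primeCompl g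
  have hf' : Function.Injective f' := LocalizedModule.map_injective p.primeCompl f hf
  have hg' : Function.Surjective g' := LocalizedModule.map_surjective p.primeCompl g hg
  have hfg' : Function.Exact f' g' := LocalizedModule.map_exact p.primeCompl f g hfg
  obtain ⟨l, hl⟩ := Module.projective_lifting_property g' LinearMap.id hg'
  exact Module.Free.of_equiv (hfg'.splitSurjectiveEquiv hf' ⟨l, hl⟩).1.symm

/-- An ideal containing a nonzerodivisor is generically free of rank one. -/
theorem isGenericallyFree_ideal {I : Ideal R} {x : R} (hx : x ∈ nonZeroDivisors R) (hxI : x ∈ I) :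
    IsGenericallyFree R I := by
  intro p _ hp
  have hxp : x ∈ p.primeCompl := fun h => notMem_nonZeroDivisors_of_mem_mem_minimalPrimes h hp hx
  have : Module.Free (Localization.AtPrime p) (LocalizedModule p.primeCompl R) :=
    Module.free_of_isLocalizedModule p.primeCompl (LocalizedModule.mkLinearMap p.primeCompl R)
  let f := LocalizedModule.map p.primeCompl I.subtype
  refine Module.Free.of_equiv (LinearEquiv.ofBijective f
    ⟨LocalizedModule.map_injective _ _ I.subtype_injective, fun y => ?_⟩).symm
  induction y using LocalizedModule.induction_on with | _ y s
  refine ⟨LocalizedModule.mk ⟨x * y, I.mul_mem_right y hxI⟩ (⟨x, hxp⟩ * s), ?_⟩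
  rw [LocalizedModule.map_mk]
  exact LocalizedModule.mk_cancel_common_left (⟨x, hxp⟩ : p.primeCompl) s y

theorem isTorsionFree_of_exact (f : M →ₗ[R] N) (g : N →ₗ[R] K)
    (hf : Function.Injective f) (hfg : Function.Exact f g)
    (hM : Module.IsTorsionFree R M) (hK : Module.IsTorsionFree R K) :
    Module.IsTorsionFree R N where
  isSMulRegular r hr := by
    rw [isSMulRegular_iff_right_eq_zero_of_smul]
    intro v hv
    have hgv : g v = 0 := isSMulRegular_iff_right_eq_zero_of_smul.mp (hK.isSMulRegular hr) _
      (by rw [← map_smul, hv, map_zero])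
    obtain ⟨w, rfl⟩ := (hfg v).mp hgv
    have hw : w = 0 := isSMulRegular_iff_right_eq_zero_of_smul.mp (hM.isSMulRegular hr) _
      (hf (by rw [map_smul, hv, map_zero]))
    rw [hw, map_zero]

/-- In a one-dimensional noetherian local ring of positive depth all associated primes are
minimal, so that an ideal contained in no minimal prime contains a nonzerodivisor. -/
theorem exists_mem_nonZeroDivisors [IsNoetherianRing R] [IsLocalRing R] [Ring.KrullDimLE 1 R]
    {x : R} (hx : x ∈ nonZeroDivisors R) (hxm : x ∈ maximalIdeal R) {I : Ideal R}
    (hI : ∀ p ∈ minimalPrimes R, ¬ I ≤ p) : ∃ r ∈ I, r ∈ nonZeroDivisors R := by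
  by_contra! h
  have hass := biUnion_associatedPrimes_eq_compl_nonZeroDivisors R
  have hsub : (I : Set R) ⊆ ⋃ p ∈ associatedPrimes R R, (p : Set R) := hass ▸ h
  obtain ⟨p, hp, hIp⟩ := (Ideal.subset_union_prime_finite (associatedPrimes.finite R R)
    (f := fun p => p) 0 0 fun _ h _ _ => h.isPrime).mp hsub
  refine hI p ((Ring.krullDimLE_one_iff.mp inferInstance p hp.isPrime).resolve_right
    fun hmax => ?_) hIp
  have hxp : x ∈ (nonZeroDivisors R : Set R)ᶜ :=
    hass ▸ Set.mem_biUnion hp ((eq_maximalIdeal hmax).symm ▸ hxm : x ∈ p)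
  exact hxp hx

/-- A nonzerodivisor annihilates the obstruction to splitting a surjection onto a generically
free module. -/
theorem IsGenericallyFree.exists_comp_eq_smul [IsNoetherianRing R] [IsLocalRing R]
    [Ring.KrullDimLE 1 R] {x : R} (hx : x ∈ nonZeroDivisors R) (hxm : x ∈ maximalIdeal R)
    [Module.Finite R M] (hM : IsGenericallyFree R M) (π : N →ₗ[R] M)
    (hπ : Function.Surjective π) :
    ∃ r ∈ nonZeroDivisors R, ∃ s : M →ₗ[R] N, π ∘ₗ s = r • LinearMap.id := by
  -- The ideal of the `r` for which `r • id` factors through `π`.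
  let I : Ideal R := (LinearMap.range (LinearMap.compRight (M := M) R π)).comap
    (LinearMap.toSpanSingleton R (M →ₗ[R] M) LinearMap.id)
  suffices h : ∃ r ∈ I, r ∈ nonZeroDivisors R by
    obtain ⟨r, ⟨s, hs⟩, hr⟩ := h
    exact ⟨r, hr, s, hs⟩
  refine exists_mem_nonZeroDivisors hx hxm fun p hp hIp => ?_
  have : p.IsPrime := hp.1.1
  have := hM p hp
  have := Module.finitePresentation_of_finite R M
  let π' := LocalizedModule.map p.primeCompl π
  obtain ⟨l, hl⟩ := Module.projective_lifting_property π' LinearMap.id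
    (LocalizedModule.map_surjective p.primeCompl π hπ)
  let a := LocalizedModule.mkLinearMap p.primeCompl M
  let b := LocalizedModule.mkLinearMap p.primeCompl N
  obtain ⟨s, t, hs⟩ := Module.FinitePresentation.exists_lift_of_isLocalizedModule p.primeCompl b
    (l.restrictScalars R ∘ₗ a)
  obtain ⟨v, hv⟩ := Module.Finite.exists_smul_of_comp_eq_of_isLocalizedModule p.primeCompl a
    (π ∘ₗ s) (t • LinearMap.id) (by
      ext y
      have h1 : b (s y) = t • l (a y) := LinearMap.congr_fun hs y
      have h2 : π' (l (a y)) = a y := LinearMap.congr_fun hl (a y)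
      have h3 : π' (b (s y)) = a (π (s y)) := by
        simp [π', a, b, LocalizedModule.map_mk, LocalizedModule.mkLinearMap_apply]
      have h4 : π' (t • l (a y)) = t • π' (l (a y)) :=
        (π'.restrictScalars R).map_smul_of_tower t (l (a y))
      simp only [LinearMap.comp_apply, LinearMap.smul_apply, LinearMap.id_apply, ← h3, h1, h4, h2]
      exact (a.map_smul_of_tower t y).symm)
  have hmem : (v * t : R) ∈ I := ⟨(v : R) • s, by
    ext y
    have := LinearMap.congr_fun hv y
    simpa [mul_smul, Submonoid.smul_def] using this⟩
  exact (v * t).2 (hIp hmem)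

end GenericallyFree

/-! ### Closure properties in terms of linear maps -/

section Closure

variable {R : Type u} [CommRing R] {P : ObjectProperty (FGModuleCat.{u} R)}
  {A B C : Type u} [AddCommGroup A] [Module R A] [Module.Finite R A]
  [AddCommGroup B] [Module R B] [Module.Finite R B]
  [AddCommGroup C] [Module R C] [Module.Finite R C]

theorem prop_of_linearRetract (hP : P.IsStableUnderRetracts) (i : A →ₗ[R] B) (r : B →ₗ[R] A)
    (h : ∀ a, r (i a) = a) (hB : P (FGModuleCat.of R B)) : P (FGModuleCat.of R A) :=
  hP.of_retract (X := FGModuleCat.of R A)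
    { i := FGModuleCat.ofHom i
      r := FGModuleCat.ofHom r
      retract := FGModuleCat.hom_ext (LinearMap.ext h) } hB

theorem prop_of_linearEquiv (hP : P.IsStableUnderRetracts) (e : A ≃ₗ[R] B)
    (hB : P (FGModuleCat.of R B)) : P (FGModuleCat.of R A) :=
  prop_of_linearRetract hP e.toLinearMap e.symm.toLinearMap e.symm_apply_apply hB

theorem prop_of_exact [IsNoetherianRing R] (hP : P.IsClosedUnderExtensions)
    (f : A →ₗ[R] B) (g : B →ₗ[R] C) (hf : Function.Injective f) (hg : Function.Surjective g)
    (hfg : Function.Exact f g)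
    (hA : P (FGModuleCat.of R A)) (hC : P (FGModuleCat.of R C)) : P (FGModuleCat.of R B) := by
  let S : ShortComplex (FGModuleCat.{u} R) :=
    ShortComplex.mk (FGModuleCat.ofHom f) (FGModuleCat.ofHom g)
      (FGModuleCat.hom_ext (LinearMap.ext fun a => hfg.apply_apply_eq_zero a))
  have hS : (S.map (forget₂ (FGModuleCat.{u} R) (ModuleCat.{u} R))).ShortExact :=
    ModuleCat.shortComplex_shortExact _ hfg hf hg
  have hS' : S.ShortExact :=
    { exact := (S.exact_map_iff_of_faithful _).mp hS.exact
      mono_f := (forget₂ (FGModuleCat.{u} R) (ModuleCat.{u} R)).mono_of_mono_map hS.mono_f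
      epi_g := (forget₂ (FGModuleCat.{u} R) (ModuleCat.{u} R)).epi_of_epi_map hS.epi_g }
  exact hP.prop_X₂_of_shortExact hS' hA hC

theorem prop_finFunction [IsNoetherianRing R] (hr : P.IsStableUnderRetracts)
    (he : P.IsClosedUnderExtensions) (hR : P (FGModuleCat.of R R)) (n : ℕ) :
    P (FGModuleCat.of R (Fin n → R)) := by
  induction n with
  | zero => exact prop_of_linearRetract hr 0 0 (fun _ => Subsingleton.elim _ _) hR
  | succ n ih =>
    refine prop_of_linearEquiv hr (Fin.consLinearEquiv R fun _ : Fin (n + 1) => R).symm ?_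
    exact prop_of_exact he (LinearMap.inl R R (Fin n → R)) (LinearMap.snd R R (Fin n → R))
      LinearMap.inl_injective LinearMap.snd_surjective .inl_snd hR ih

theorem isClosedUnderExtensions_of_exact [IsNoetherianRing R]
    (h : ∀ (X Y Z : FGModuleCat.{u} R) (f : X →ₗ[R] Y) (g : Y →ₗ[R] Z), Function.Injective f →
      Function.Surjective g → Function.Exact f g → P X → P Z → P Y) :
    P.IsClosedUnderExtensions where
  prop_X₂_of_shortExact {S} hS h₁ h₃ := by
    have hS' : (S.map (forget₂ (FGModuleCat.{u} R) (ModuleCat.{u} R))).ShortExact :=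
      hS.map_of_exact _
    exact h _ _ _ S.f.hom.hom S.g.hom.hom hS'.moduleCat_injective_f hS'.moduleCat_surjective_g
      ((ShortComplex.ShortExact.moduleCat_exact_iff_function_exact _).mp hS'.exact) h₁ h₃

theorem isStableUnderRetracts_of_linearRetract
    (h : ∀ (X Y : FGModuleCat.{u} R) (i : X →ₗ[R] Y) (r : Y →ₗ[R] X),
      r ∘ₗ i = LinearMap.id → P Y → P X) : P.IsStableUnderRetracts where
  of_retract {X Y} ret hY := h X Y ret.i.hom.hom ret.r.hom.hom
    (congrArg (fun f => f.hom.hom) ret.retract) hY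

instance isStableUnderRetracts_finiteLengthModules :
    (finiteLengthModules R).IsStableUnderRetracts :=
  isStableUnderRetracts_of_linearRetract fun _ _ _ r h hY =>
    IsFiniteLength.of_surjective hY (f := r) fun a => ⟨_, LinearMap.congr_fun h a⟩

instance isClosedUnderExtensions_finiteLengthModules [IsNoetherianRing R] :
    (finiteLengthModules R).IsClosedUnderExtensions :=
  isClosedUnderExtensions_of_exact fun X Y Z f g hf hg hfg hX hZ => by
    rw [finiteLengthModules, isFiniteLength_iff_isNoetherian_isArtinian] at *
    have := hX.2
    have := hZ.2
    exact ⟨inferInstance, isArtinian_of_range_eq_ker f g (LinearMap.exact_iff.mp hfg).symm⟩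

instance isStableUnderRetracts_genericallyFreeTorsionfreeModules :
    (genericallyFreeTorsionfreeModules R).IsStableUnderRetracts :=
  isStableUnderRetracts_of_linearRetract fun _ _ i r h hY =>
    have := hY.1
    have hi : Function.Injective i := Function.LeftInverse.injective (LinearMap.congr_fun h)
    ⟨hi.moduleIsTorsionFree i (map_smul i), hY.2.of_retract i r h⟩

instance isClosedUnderExtensions_genericallyFreeTorsionfreeModules [IsNoetherianRing R] :
    (genericallyFreeTorsionfreeModules R).IsClosedUnderExtensions :=
  isClosedUnderExtensions_of_exact fun _ _ _ f g hf hg hfg hX hZ =>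
    ⟨isTorsionFree_of_exact f g hf hfg hX.1 hZ.1, .of_exact f g hf hg hfg hX.2 hZ.2⟩

end Closure

/-! ### Lowering the exponent -/

section Lowering

variable {R : Type u} [CommRing R] [IsNoetherianRing R] [IsLocalRing R]
  {P : ObjectProperty (FGModuleCat.{u} R)}

/-- With `I` a complement of `x 𝔪ⁿ` in `𝔪ⁿ⁺¹` modulo `𝔪ⁿ⁺²`, there is an exact sequence
`0 → 𝔪ⁿ⁺¹ → I × 𝔪ⁿ → 𝔪ⁿ⁺¹ → 0`, with maps `a ↦ (x a, a)` and `(b, c) ↦ b - x c`. -/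
theorem prop_maximalIdeal_pow_of_succ (hr : P.IsStableUnderRetracts)
    (he : P.IsClosedUnderExtensions) {x : R} (hx : x ∈ maximalIdeal R)
    (hcolon : ∀ n z, x * z ∈ maximalIdeal R ^ (n + 1) → z ∈ maximalIdeal R ^ n) (n : ℕ)
    (hn : P (FGModuleCat.of R ↥(maximalIdeal R ^ (n + 1)))) :
    P (FGModuleCat.of R ↥(maximalIdeal R ^ n)) := by
  obtain ⟨I, hI₁, hI₂, hI₃, hI₄⟩ := exists_ideal_complement x n
  have hle : maximalIdeal R ^ (n + 1) ≤ maximalIdeal R ^ n := Ideal.pow_le_pow_right (by omega)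
  have hxmul : ∀ k, ∀ z ∈ maximalIdeal R ^ k, x * z ∈ maximalIdeal R ^ (k + 1) :=
    fun k z hz => pow_succ' (maximalIdeal R) k ▸ Ideal.mul_mem_mul hx hz
  let μ : R →ₗ[R] R := LinearMap.mulLeft R x
  let f : ↥(maximalIdeal R ^ (n + 1)) →ₗ[R] I × ↥(maximalIdeal R ^ n) :=
    (μ.restrict fun a ha => hI₁ (hxmul _ a ha)).prod (Submodule.inclusion hle)
  let g : I × ↥(maximalIdeal R ^ n) →ₗ[R] ↥(maximalIdeal R ^ (n + 1)) :=
    (Submodule.inclusion hI₂).coprod (-(μ.restrict fun c hc => hxmul _ c hc))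
  refine prop_of_linearRetract hr (LinearMap.inr R I _) (LinearMap.snd R I _) (fun _ => rfl)
    (prop_of_exact he f g ?_ ?_ ?_ hn hn)
  · exact fun a b h => Subtype.ext (congrArg (fun v => (v.2 : R)) h)
  · intro b
    obtain ⟨z, hz, hbz⟩ := hI₄ b b.2
    refine ⟨(⟨b - x * z, hbz⟩, -⟨z, hz⟩), Subtype.ext ?_⟩
    change b - x * z + -(x * -z) = (b : R)
    ring
  · rintro ⟨⟨b, hb⟩, ⟨c, hc⟩⟩
    have hg : g (⟨b, hb⟩, ⟨c, hc⟩) = 0 ↔ b = x * c := by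
      rw [← sub_eq_zero (a := b), sub_eq_add_neg]
      exact Subtype.ext_iff
    rw [hg]
    constructor
    · rintro rfl
      exact ⟨⟨c, hcolon _ _ (hI₃ c hc hb)⟩, rfl⟩
    · rintro ⟨a, ha⟩
      have h₁ : x * (a : R) = b := congrArg (fun v => (v.1 : R)) ha
      have h₂ : (a : R) = c := congrArg (fun v => (v.2 : R)) ha
      rw [← h₁, h₂]

/-- The exact sequence `0 → R/𝔪ⁿ⁺¹ → R/I × R/𝔪ⁿ → R/𝔪ⁿ⁺¹ → 0`, the quotient of the split exact
sequence `0 → R → R × R → R → 0` with maps `a ↦ (x a, a)` and `(b, c) ↦ b - x c` by the sequence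
`0 → 𝔪ⁿ⁺¹ → I × 𝔪ⁿ → 𝔪ⁿ⁺¹ → 0`. -/
theorem prop_quotient_maximalIdeal_pow_of_succ (hr : P.IsStableUnderRetracts)
    (he : P.IsClosedUnderExtensions) {x : R} (hx : x ∈ maximalIdeal R)
    (hcolon : ∀ n z, x * z ∈ maximalIdeal R ^ (n + 1) → z ∈ maximalIdeal R ^ n) (n : ℕ)
    (hn : P (FGModuleCat.of R (R ⧸ maximalIdeal R ^ (n + 1)))) :
    P (FGModuleCat.of R (R ⧸ maximalIdeal R ^ n)) := by
  obtain ⟨I, hI₁, hI₂, hI₃, hI₄⟩ := exists_ideal_complement x n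
  have hle : maximalIdeal R ^ (n + 1) ≤ maximalIdeal R ^ n := Ideal.pow_le_pow_right (by omega)
  have hxmul : ∀ k, ∀ z ∈ maximalIdeal R ^ k, x * z ∈ maximalIdeal R ^ (k + 1) :=
    fun k z hz => pow_succ' (maximalIdeal R) k ▸ Ideal.mul_mem_mul hx hz
  let μ : R →ₗ[R] R := LinearMap.mulLeft R x
  let f : (R ⧸ maximalIdeal R ^ (n + 1)) →ₗ[R] (R ⧸ I) × (R ⧸ maximalIdeal R ^ n) :=
    (Submodule.mapQ _ I μ fun a ha => hI₁ (hxmul _ a ha)).prod (Submodule.factor hle)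
  let g : (R ⧸ I) × (R ⧸ maximalIdeal R ^ n) →ₗ[R] R ⧸ maximalIdeal R ^ (n + 1) :=
    (Submodule.factor hI₂).coprod (-(Submodule.mapQ _ _ μ fun c hc => hxmul _ c hc))
  have hf (a : R) : f (Submodule.Quotient.mk a) =
    (Submodule.Quotient.mk (x * a), Submodule.Quotient.mk a) := rfl
  have hg (b c : R) : g (Submodule.Quotient.mk b, Submodule.Quotient.mk c) =
      Submodule.Quotient.mk (b - x * c) := by
    rw [sub_eq_add_neg]
    rfl
  refine prop_of_linearRetract hr (LinearMap.inr R (R ⧸ I) _) (LinearMap.snd R (R ⧸ I) _)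
    (fun _ => rfl) (prop_of_exact he f g ?_ ?_ ?_ hn hn)
  · rw [injective_iff_map_eq_zero]
    intro a ha
    obtain ⟨a, rfl⟩ := Submodule.Quotient.mk_surjective _ a
    rw [hf, Prod.mk_eq_zero, Submodule.Quotient.mk_eq_zero, Submodule.Quotient.mk_eq_zero] at ha
    exact (Submodule.Quotient.mk_eq_zero _).mpr (hcolon _ _ (hI₃ a ha.2 ha.1))
  · intro b
    obtain ⟨b, rfl⟩ := Submodule.Quotient.mk_surjective _ b
    exact ⟨(Submodule.Quotient.mk b, Submodule.Quotient.mk 0), by rw [hg, mul_zero, sub_zero]⟩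
  · rintro ⟨b, c⟩
    obtain ⟨b, rfl⟩ := Submodule.Quotient.mk_surjective _ b
    obtain ⟨c, rfl⟩ := Submodule.Quotient.mk_surjective _ c
    rw [hg, Submodule.Quotient.mk_eq_zero]
    constructor
    · intro h
      obtain ⟨z, hz, hbz⟩ := hI₄ _ h
      refine ⟨Submodule.Quotient.mk (c + z), ?_⟩
      rw [hf, Prod.mk.injEq, Submodule.Quotient.eq, Submodule.Quotient.eq]
      constructor
      · convert neg_mem hbz using 1
        ring
      · simpa using hz
    · rintro ⟨a, ha⟩
      obtain ⟨a, rfl⟩ := Submodule.Quotient.mk_surjective _ a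
      rw [hf, Prod.mk.injEq, Submodule.Quotient.eq, Submodule.Quotient.eq] at ha
      have h₁ := sub_mem (hxmul _ _ ha.2) (hI₂ ha.1)
      convert h₁ using 1
      ring

end Lowering

/-! ### Kernels of maps onto modules of finite length -/

section FiniteLength

theorem isFiniteLength_quotient_range_smul {R : Type u} [CommRing R]
    [IsNoetherianRing R] [Ring.KrullDimLE 1 R] {r : R} (hr : r ∈ nonZeroDivisors R)
    (M : Type u) [AddCommGroup M] [Module R M] [Module.Finite R M] :
    IsFiniteLength R (M ⧸ LinearMap.range (r • (LinearMap.id : M →ₗ[R] M))) := by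
  obtain ⟨n, π, hπ⟩ := Module.Finite.exists_fin' R M
  have := (isFiniteLength_iff_isNoetherian_isArtinian.mp
    (isFiniteLength_quotient_span_singleton R hr)).2
  have hfl : IsFiniteLength R (Fin n → R ⧸ Ideal.span {r}) :=
    isFiniteLength_iff_isNoetherian_isArtinian.mpr ⟨inferInstance, inferInstance⟩
  have hfl' := (Submodule.quotientPi fun _ : Fin n => Ideal.span {r}).symm.isFiniteLength hfl
  let q := (LinearMap.range (r • (LinearMap.id : M →ₗ[R] M))).mkQ
  refine hfl'.of_surjective (f := Submodule.liftQ _ (q ∘ₗ π) fun v hv => ?_) ?_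
  · have hv' (j : Fin n) : ∃ c, v j = r * c := Ideal.mem_span_singleton.mp (hv j trivial)
    choose w hw using hv'
    obtain rfl : v = r • w := funext hw
    exact (Submodule.Quotient.mk_eq_zero _).mpr ⟨π w, (map_smul π r w).symm⟩
  · exact fun t => by
      obtain ⟨v, rfl⟩ := (Submodule.mkQ_surjective _).comp hπ t
      exact ⟨Submodule.Quotient.mk v, rfl⟩

theorem exists_linearEquiv_residue {R : Type u} [CommRing R] [IsLocalRing R] (S : Type u)
    [AddCommGroup S] [Module R S] [IsSimpleModule R S] : Nonempty (S ≃ₗ[R] R ⧸ maximalIdeal R) := by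
  obtain ⟨I, hI, ⟨e⟩⟩ := isSimpleModule_iff_quot_maximal.mp ‹IsSimpleModule R S›
  obtain rfl := eq_maximalIdeal hI
  exact ⟨e⟩

variable {R : Type u} [CommRing R] [IsNoetherianRing R] [IsLocalRing R]
  {P : ObjectProperty (FGModuleCat.{u} R)}

theorem prop_of_isFiniteLength (hr : P.IsStableUnderRetracts) (he : P.IsClosedUnderExtensions)
    (hk : P (FGModuleCat.of R (R ⧸ maximalIdeal R))) {T : Type u} [AddCommGroup T] [Module R T]
    (hT : IsFiniteLength R T) : ∀ [Module.Finite R T], P (FGModuleCat.of R T) := by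
  induction hT with
  | @of_subsingleton T _ _ _ =>
    exact prop_of_linearRetract hr 0 0 (fun _ => Subsingleton.elim (α := T) _ _) hk
  | @of_simple_quotient T _ _ N _ _ ih =>
    intro _
    obtain ⟨e⟩ := exists_linearEquiv_residue (R := R) (T ⧸ N)
    exact prop_of_exact he N.subtype N.mkQ N.injective_subtype N.mkQ_surjective
      (LinearMap.exact_subtype_mkQ N) ih (prop_of_linearEquiv hr e hk)

/-- The kernel `K` of a map from `L` onto a simple module `S` is a direct summand of the fibre
product `L ×_S R`, because the map `R → S` lifts to `L`; and the fibre product is an extension of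
`L` by `𝔪`. -/
theorem prop_ker_of_isSimpleModule (hr : P.IsStableUnderRetracts)
    (he : P.IsClosedUnderExtensions) (hm : P (FGModuleCat.of R (maximalIdeal R))) {L S : Type u}
    [AddCommGroup L] [Module R L] [Module.Finite R L] [AddCommGroup S] [Module R S]
    [IsSimpleModule R S] (hL : P (FGModuleCat.of R L)) (g : L →ₗ[R] S)
    (hg : Function.Surjective g) : P (FGModuleCat.of R (LinearMap.ker g)) := by
  obtain ⟨e⟩ := exists_linearEquiv_residue (R := R) S
  let π : R →ₗ[R] S := e.symm.toLinearMap ∘ₗ (maximalIdeal R).mkQ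
  have hπ : Function.Surjective π := e.symm.surjective.comp (Submodule.mkQ_surjective _)
  have hπ0 (r : R) : π r = 0 ↔ r ∈ maximalIdeal R := by
    simp only [π, LinearMap.comp_apply, LinearEquiv.coe_coe, EmbeddingLike.map_eq_zero_iff,
      Submodule.mkQ_apply, Submodule.Quotient.mk_eq_zero]
  obtain ⟨σ, hσ⟩ := Module.projective_lifting_property g π hg
  replace hσ (r : R) : g (σ r) = π r := LinearMap.congr_fun hσ r
  let D : Submodule R (L × R) := LinearMap.ker (g.coprod (-π))
  have hD (l : L) (r : R) : (l, r) ∈ D ↔ g l = π r := by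
    simp [D, ← sub_eq_add_neg, sub_eq_zero]
  have hPD : P (FGModuleCat.of R D) := by
    refine prop_of_exact he
      (((LinearMap.inr R L R).comp (maximalIdeal R).subtype).codRestrict D fun r =>
        (hD _ _).mpr ?_)
      ((LinearMap.fst R L R).comp D.subtype) ?_ ?_ ?_ hm hL
    · exact (map_zero g).trans ((hπ0 r).mpr r.2).symm
    · exact fun r s h => Subtype.ext (congrArg (fun v : D => (v : L × R).2) h)
    · intro l
      obtain ⟨r, hr⟩ := hπ (g l)
      exact ⟨⟨(l, r), (hD _ _).mpr hr.symm⟩, rfl⟩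
    · rintro ⟨⟨l, r⟩, h⟩
      constructor
      · rintro rfl
        rw [hD, map_zero, eq_comm, hπ0] at h
        exact ⟨⟨r, h⟩, rfl⟩
      · rintro ⟨s, hs⟩
        exact (congrArg (fun v : D => (v : L × R).1) hs).symm
  refine prop_of_linearRetract hr
    (((LinearMap.inl R L R).comp (LinearMap.ker g).subtype).codRestrict D fun l =>
      (hD _ _).mpr ((map_zero π).symm ▸ l.2))
    (((LinearMap.fst R L R - σ ∘ₗ LinearMap.snd R L R).comp D.subtype).codRestrict
      (LinearMap.ker g) fun v => ?_) (fun l => Subtype.ext ?_) hPD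
  · obtain ⟨⟨l, r⟩, h⟩ := v
    have := (hD l r).mp h
    simp [hσ, this]
  · change (l : L) - σ 0 = l
    rw [map_zero, sub_zero]

theorem prop_ker_of_isFiniteLength (hr : P.IsStableUnderRetracts)
    (he : P.IsClosedUnderExtensions) (hm : P (FGModuleCat.of R (maximalIdeal R))) {T : Type u}
    [AddCommGroup T] [Module R T] (hT : IsFiniteLength R T) {L : Type u}
    [AddCommGroup L] [Module R L] [Module.Finite R L] (hL : P (FGModuleCat.of R L))
    (g : L →ₗ[R] T) (hg : Function.Surjective g) : P (FGModuleCat.of R (LinearMap.ker g)) := by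
  induction hT generalizing L with
  | of_subsingleton =>
    refine prop_of_linearRetract hr (LinearMap.ker g).subtype
      (LinearMap.id.codRestrict _ fun _ => Subsingleton.elim _ _) (fun _ => rfl) hL
  | @of_simple_quotient T _ _ N _ _ ih =>
    let h : L →ₗ[R] T ⧸ N := N.mkQ ∘ₗ g
    have hmem (l : L) : l ∈ LinearMap.ker h ↔ g l ∈ N := by simp [h]
    let g' : LinearMap.ker h →ₗ[R] N := g.restrict fun l hl => (hmem l).mp hl
    have hg' : Function.Surjective g' := by
      rintro ⟨t, ht⟩
      obtain ⟨l, rfl⟩ := hg t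
      exact ⟨⟨l, (hmem l).mpr ht⟩, rfl⟩
    have hker := ih (prop_ker_of_isSimpleModule hr he hm hL h
      (N.mkQ_surjective.comp hg)) g' hg'
    have hmem' (l : LinearMap.ker h) : l ∈ LinearMap.ker g' ↔ (l : L) ∈ LinearMap.ker g := by
      rw [LinearMap.mem_ker, LinearMap.mem_ker]
      exact Subtype.ext_iff
    refine prop_of_linearRetract hr
      (((LinearMap.ker g).subtype.codRestrict (LinearMap.ker h) fun l =>
        (hmem _).mpr (by simp)).codRestrict (LinearMap.ker g') fun l => (hmem' _).mpr l.2)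
      (((LinearMap.ker h).subtype.comp (LinearMap.ker g').subtype).codRestrict (LinearMap.ker g)
        fun l => (hmem' _).mp l.2) (fun l => rfl) hker

/-- If `r` is a nonzerodivisor and multiplication by `r` on `M` factors through a free cover
`π : F → M`, then `M` is a direct summand of `π⁻¹(r M)`, the kernel of the map from `F` onto the
finite length module `M / r M`. -/
theorem prop_of_isGenericallyFree [Ring.KrullDimLE 1 R] (hr : P.IsStableUnderRetracts)
    (he : P.IsClosedUnderExtensions) (hR : P (FGModuleCat.of R R))
    (hm : P (FGModuleCat.of R (maximalIdeal R))) {x : R} (hx : x ∈ nonZeroDivisors R)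
    (hxm : x ∈ maximalIdeal R) {M : Type u} [AddCommGroup M] [Module R M] [Module.Finite R M]
    (htf : Module.IsTorsionFree R M) (hgf : IsGenericallyFree R M) :
    P (FGModuleCat.of R M) := by
  obtain ⟨n, π, hπ⟩ := Module.Finite.exists_fin' R M
  obtain ⟨r, hr₀, s, hs⟩ := hgf.exists_comp_eq_smul hx hxm π hπ
  let ρ : M →ₗ[R] M := r • LinearMap.id
  have hρ : Function.Injective ρ := htf.isSMulRegular (isRegular_iff_mem_nonZeroDivisors.mpr hr₀)
  let g := (LinearMap.range ρ).mkQ ∘ₗ π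
  have hmem (v : Fin n → R) : v ∈ LinearMap.ker g ↔ π v ∈ LinearMap.range ρ := by
    simp [g]
  have hs' (m : M) : π (s m) = ρ m := LinearMap.congr_fun hs m
  let e := LinearEquiv.ofInjective ρ hρ
  refine prop_of_linearRetract hr (s.codRestrict (LinearMap.ker g) fun m =>
      (hmem _).mpr ⟨m, (hs' m).symm⟩)
    (e.symm.toLinearMap ∘ₗ π.restrict fun v hv => (hmem v).mp hv) (fun m => ?_)
    (prop_ker_of_isFiniteLength hr he hm (isFiniteLength_quotient_range_smul hr₀ M)
      (prop_finFunction hr he hR n) g ((Submodule.mkQ_surjective _).comp hπ))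
  exact e.symm_apply_eq.mpr (Subtype.ext (hs' m))

end FiniteLength

end ExtensionClosure

open ExtensionClosure in
theorem theorem5p4 {R : Type u} [CommRing R] [IsNoetherianRing R] [IsLocalRing R]
    (hCM : ExtensionClosure.IsCohenMacaulayLocal R) (hdim : ringKrullDim R = 1)
    (hk : Infinite (IsLocalRing.ResidueField R))
    (hgr : 0 < ExtensionClosure.depthAssociatedGraded R) (i : ℕ) (hi : 1 ≤ i) :
    ExtensionClosure.extClosure R (FGModuleCat.of R (R ⧸ IsLocalRing.maximalIdeal R ^ i)) =
        ExtensionClosure.finiteLengthModules R ∧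
      ExtensionClosure.extClosure R (FGModuleCat.of R ↥(IsLocalRing.maximalIdeal R ^ i)) =
        ExtensionClosure.genericallyFreeTorsionfreeModules R := by
  obtain ⟨x, hx, hreg, hcolon⟩ := exists_superficial hgr
  have : Ring.KrullDimLE 1 R := Ring.krullDimLE_iff.mpr hdim.le
  constructor
  · refine le_antisymm (sInf_le ⟨?_, inferInstance, inferInstance⟩)
      (le_sInf fun P ⟨hP, hr, he⟩ X hX => ?_)
    · -- `xⁱ` is a nonzerodivisor in `𝔪ⁱ`, so that `R / 𝔪ⁱ` is a quotient of `R / (xⁱ)`.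
      have hle : Ideal.span {x ^ i} ≤ IsLocalRing.maximalIdeal R ^ i :=
        (Ideal.span_singleton_le_iff_mem _).mpr (Ideal.pow_mem_pow hx i)
      exact (isFiniteLength_quotient_span_singleton R (pow_mem hreg i)).of_surjective
        (Submodule.factor_surjective hle)
    · have hres : P (FGModuleCat.of R (R ⧸ IsLocalRing.maximalIdeal R ^ 1)) :=
        Nat.decreasingInduction' (P := fun n =>
          P (FGModuleCat.of R (R ⧸ IsLocalRing.maximalIdeal R ^ n)))
          (fun n _ _ h => prop_quotient_maximalIdeal_pow_of_succ hr he hx hcolon n h) hi hP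
      rw [pow_one] at hres
      exact prop_of_isFiniteLength hr he hres hX
  · refine le_antisymm (sInf_le ⟨?_, inferInstance, inferInstance⟩)
      (le_sInf fun P ⟨hP, hr, he⟩ X hX => ?_)
    · exact ⟨inferInstanceAs (Module.IsTorsionFree R ↥(IsLocalRing.maximalIdeal R ^ i)),
        isGenericallyFree_ideal (pow_mem hreg i) (Ideal.pow_mem_pow hx i)⟩
    · have hpow (j : ℕ) (hj : j ≤ i) :
          P (FGModuleCat.of R ↥(IsLocalRing.maximalIdeal R ^ j)) :=
        Nat.decreasingInduction' (P := fun n =>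
          P (FGModuleCat.of R ↥(IsLocalRing.maximalIdeal R ^ n)))
          (fun n _ _ h => prop_maximalIdeal_pow_of_succ hr he hx hcolon n h) hj hP
      refine prop_of_isGenericallyFree hr he ?_ ?_ hreg hx hX.1 hX.2
      · exact prop_of_linearEquiv hr
          (Submodule.topEquiv.symm.trans (LinearEquiv.ofEq _ _ (by simp))) (hpow 0 (Nat.zero_le i))
      · exact prop_of_linearEquiv hr (LinearEquiv.ofEq _ _ (pow_one _).symm) (hpow 1 hi)
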